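/- **Setting.** Let $G=(V,E)$ be a finite simple graph and let $V\to[k]$ be any fixed coloring of its nodes with $k$ colors; a set of nodes or a subgraph is *colorful* if its nodes have pairwise distinct colors. Let $H_1,\dots,H_s$ be all connected graphs on $k$ nodes up to isomorphism (the $k$-graphlets), and let $T_1,\dots,T_\varsigma$ be all trees on $k$ nodes up to isomorphism (the $k$-treelets). Let $g_i$ be the number of colorful induced copies of $H_i$ in $G$, let $t_j$ be the number of colorful, not necessarily induced, copies of $T_j$ in $G$, and let $\sigma_{ij}$ be the number of spanning trees of $H_i$ isomorphic to $T_j$. For $t_j>0$, $\mathrm{sample}(T_j)$ returns a uniformly random colorful copy of $T_j$ in $G$; the copy *spans* the graphlet $H_i$ if its nodes induce in $G$ a graph isomorphic to $H_i$. **Algorithm AGS$(\epsilon,\delta)$.** Put $\bar c=\lceil \frac{4}{\epsilon^2}\ln\frac{2s}{\delta}\rceil$. Start with $c_i=w_i=0$ for all $i$, $C=\emptyset$, and an arbitrary treelet $T_j$ with $t_j>0$. While $|C|<s$: add $\sigma_{i'j}/t_j$ to $w_{i'}$ for every $i'\in\{1,\dots,s\}$; draw a fresh $\mathrm{sample}(T_j)$,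 let $H_i$ be the graphlet it spans, and increase $c_i$ by $1$; if now $c_i\ge\bar c$, add $i$ to $C$ (then $H_i$ is *covered*) and replace $T_j$ by a newly selected treelet $T_{j^*}$. When the loop ends, return $(c_1/w_1,\dots,c_s/w_s)$. **Theorem.** Let $0<\epsilon\le 0.65$ and $0<\delta<1$. Suppose that every treelet $T_{j^*}$ selected by AGS minimizes, among the treelets with $t_j>0$, the probability $$\Pr[\mathrm{sample}(T_j)\text{ spans a copy of some }H_i,\ i\in C]$$ for the current set $C$. Then, with probability at least $1-\delta$, when AGS stops, the value $c_i/w_i$ is a multiplicative $(1\pm\epsilon)$-approximation of $g_i$ for all $i=1,\dots,s$ simultaneously, that is, $$(1-\epsilon)\,g_i\le \frac{c_i}{w_i}\le(1+\epsilon)\,g_i .$$ Moreover, if $g_i>0$ for all $i$, then AGS stops with probability $1$. (If AGS does not stop, the first claim imposes nothing.) -/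

import Mathlib

open MeasureTheory

namespace AGS

/-- Isomorphism of connected graphs on `Fin k`. -/
def graphletSetoid (k : ℕ) : Setoid {H : SimpleGraph (Fin k) // H.Connected} where
  r H H' := Nonempty (H.1 ≃g H'.1)
  iseqv :=
    ⟨fun _ => ⟨RelIso.refl _⟩, fun ⟨e⟩ => ⟨e.symm⟩, fun ⟨e⟩ ⟨f⟩ => ⟨e.trans f⟩⟩

/-- The type of `k`-graphlets: isomorphism classes of connected graphs on `k` nodes. -/
def Graphlet (k : ℕ) : Type := Quotient (graphletSetoid k)

/-- A graph `H_i` representing the graphlet `i`. -/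
noncomputable def Graphlet.graph {k : ℕ} (i : Graphlet k) : SimpleGraph (Fin k) :=
  (Quotient.out i).1

/-- Isomorphism of trees on `Fin k`. -/
def treeletSetoid (k : ℕ) : Setoid {T : SimpleGraph (Fin k) // T.IsTree} where
  r T T' := Nonempty (T.1 ≃g T'.1)
  iseqv :=
    ⟨fun _ => ⟨RelIso.refl _⟩, fun ⟨e⟩ => ⟨e.symm⟩, fun ⟨e⟩ ⟨f⟩ => ⟨e.trans f⟩⟩

/-- The type of `k`-treelets: isomorphism classes of trees on `k` nodes. -/
def Treelet (k : ℕ) : Type := Quotient (treeletSetoid k)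

/-- A tree `T_j` representing the treelet `j`. -/
noncomputable def Treelet.graph {k : ℕ} (j : Treelet k) : SimpleGraph (Fin k) :=
  (Quotient.out j).1

/-- The number `s` of distinct `k`-graphlets. -/
noncomputable def numGraphlets (k : ℕ) : ℕ := Nat.card (Graphlet k)

/-- `σ_{ij}`: the number of spanning trees of `H_i` that are isomorphic to `T_j`. -/
noncomputable def sigma {k : ℕ} (i : Graphlet k) (j : Treelet k) : ℕ :=
  {T : SimpleGraph (Fin k) | T ≤ i.graph ∧ Nonempty (T ≃g j.graph)}.ncard

section Host

variable {k : ℕ} {V : Type*} (G : SimpleGraph V) (col : V → Fin k)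

/-- The colorful induced copies of `H_i` in the colored graph `G`, each given by its node set. -/
def graphletCopies (i : Graphlet k) : Set (Set V) :=
  {S | Set.InjOn col S ∧ Nonempty (G.induce S ≃g i.graph)}

/-- `g_i`: the number of colorful induced copies of `H_i` in `G`. -/
noncomputable def graphletCount (i : Graphlet k) : ℕ := (graphletCopies G col i).ncard

/-- The colorful (not necessarily induced) copies of the treelet `T_j` in `G`. -/
def treeletCopies (j : Treelet k) : Set G.Subgraph :=
  {x | Set.InjOn col x.verts ∧ Nonempty (x.coe ≃g j.graph)}

/-- `t_j`: the number of colorful copies of `T_j` in `G`. -/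
noncomputable def treeletCount (j : Treelet k) : ℕ := (treeletCopies G col j).ncard

/-- The subgraph of `G` induced by the nodes of `x` is a copy of `H_i`. -/
def Spans {G : SimpleGraph V} (x : G.Subgraph) (i : Graphlet k) : Prop :=
  Nonempty (G.induce x.verts ≃g i.graph)

/-- The probability that `sample(T_j)`, a uniformly random colorful copy of `T_j` in `G`,
spans a copy of some `H_i` with `i ∈ C`. It is meaningful only if `t_j > 0`. -/
noncomputable def probSpans (j : Treelet k) (C : Set (Graphlet k)) : ℝ :=
  ({x | x ∈ treeletCopies G col j ∧ ∃ i ∈ C, Spans x i}.ncard : ℝ) / treeletCount G col j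

/-- Among all treelets that can be sampled (those with `t_j > 0`), `T_j` minimizes the probability
that a sample spans a copy of some `H_i` with `i ∈ C`. -/
def MinimizesCovered (j : Treelet k) (C : Set (Graphlet k)) : Prop :=
  0 < treeletCount G col j ∧
    ∀ j' : Treelet k, 0 < treeletCount G col j' → probSpans G col j C ≤ probSpans G col j' C

/-- The covering threshold `⌈(4 / ε²) ln (2 s / δ)⌉`. -/
noncomputable def threshold (k : ℕ) (ε δ : ℝ) : ℕ :=
  ⌈4 / ε ^ 2 * Real.log (2 * (numGraphlets k : ℝ) / δ)⌉₊

variable {Ω : Type*} (J : ℕ → Ω → Treelet k)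

/-! Below, `J t ω` is the treelet sampled in iteration `t` (counted from `0`) of the main loop, and
`X t ω` is the treelet copy drawn in that iteration. -/

open Classical in
/-- `c_i` after `t` iterations: how many of the copies drawn so far span `H_i`. -/
noncomputable def count {G : SimpleGraph V} (X : ℕ → Ω → G.Subgraph)
    (i : Graphlet k) (t : ℕ) (ω : Ω) : ℕ :=
  ∑ u ∈ Finset.range t, if Spans (X u ω) i then 1 else 0

/-- `w_i` after `t` iterations. -/
noncomputable def weight (i : Graphlet k) (t : ℕ) (ω : Ω) : ℝ :=
  ∑ u ∈ Finset.range t, (sigma i (J u ω) : ℝ) / treeletCount G col (J u ω)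

variable {G} (X : ℕ → Ω → G.Subgraph) (cbar : ℕ)

/-- The set `C` of covered graphlets after `t` iterations. -/
def covered (t : ℕ) (ω : Ω) : Set (Graphlet k) := {i | cbar ≤ count X i t ω}

/-- After `t` iterations the loop condition `|C| < s` still holds, so that iteration `t` is
executed. -/
def Running (k : ℕ) (X : ℕ → Ω → G.Subgraph) (cbar : ℕ) (t : ℕ) (ω : Ω) : Prop :=
  (covered X cbar t ω : Set (Graphlet k)) ≠ Set.univ

/-- The algorithm stops after exactly `t` iterations. -/
def StopsAt (k : ℕ) (X : ℕ → Ω → G.Subgraph) (cbar : ℕ) (t : ℕ) (ω : Ω) : Prop :=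
  ¬ Running k X cbar t ω ∧ ∀ u < t, Running k X cbar u ω

/-- The random process `(J, X)` is an execution of AGS on the colored graph `G` with covering
threshold `cbar`, up to the rule by which a new treelet is selected. Here `ℱ t` is the information
available before the draw in iteration `t`. Nothing is required after the algorithm has stopped. -/
structure IsRun [MeasurableSpace Ω] (μ : Measure Ω) (ℱ : Filtration ℕ ‹MeasurableSpace Ω›) :
    Prop where
  /-- The treelet to be sampled is known before the draw. -/
  adapted_J : ∀ t j, MeasurableSet[ℱ t] {ω | J t ω = j}
  /-- The drawn copy is known after the draw. -/
  adapted_X : ∀ t x, MeasurableSet[ℱ (t + 1)] {ω | X t ω = x}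
  /-- The initial treelet is arbitrary among those that can be sampled. -/
  initial : ∀ ω, 0 < treeletCount G col (J 0 ω)
  /-- Conditionally on the past, the copy drawn is uniform among the colorful copies of the
  current treelet. -/
  uniform : ∀ t j, ∀ x ∈ treeletCopies G col j, ∀ A : Set Ω, MeasurableSet[ℱ t] A →
    (∀ ω ∈ A, Running k X cbar t ω ∧ J t ω = j) →
      μ (A ∩ {ω | X t ω = x}) = μ A / (treeletCount G col j : ENNReal)
  /-- If the graphlet just sampled is still below the threshold, the treelet is kept. -/
  keep : ∀ t ω, Running k X cbar t ω →
    (∀ i : Graphlet k, Spans (X t ω) i → count X i (t + 1) ω < cbar) → J (t + 1) ω = J t ω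

/-- Whenever the graphlet just sampled has reached the threshold, the treelet `T_{j*}` selected for
the next iteration minimizes the (true) probability that a sample spans a covered graphlet. -/
def SwitchesOptimally : Prop :=
  ∀ t ω, Running k X cbar t ω → ∀ i : Graphlet k, Spans (X t ω) i → cbar ≤ count X i (t + 1) ω →
    MinimizesCovered G col (J (t + 1) ω) (covered X cbar (t + 1) ω)

end Host

end AGS

/-!
Fix a graphlet `H_i`. When `T_j` is sampled, the copy drawn spans `H_i` with probability
`p = g_i σ_{ij} / t_j`, by double counting (`AGS.ncard_copies_spanning`). The weight `w_i` is the sum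
of the `σ_{ij} / t_j`, so `g_i w_i` is the compensator of the count `c_i`, however the treelets are
selected. Since `1 + r p ≤ exp (r p)`, the process `(1 + r) ^ c_i * exp (-r g_i w_i)` is, for every
`r > -1`, a nonnegative supermartingale with initial value `1`; frozen when the algorithm stops, it
is `AGS.tilt`, and its expectation never exceeds `1` (`AGS.IsRun.lintegral_tilt_le_one`).

Accuracy. At the stopping time every count is at least the threshold `cbar`. If moreover
`c_i > (1 + ε) g_i w_i`, the process with `r = ε` is at least
`exp (cbar (log (1 + ε) - ε / (1 + ε)))`; if `c_i < (1 - ε) g_i w_i`, the one with `r = -ε` is at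
least `exp (cbar (log (1 - ε) + ε / (1 - ε)))`. Both exponents are at least `cbar ε² / 4`, the first
one because `ε ≤ 13/20` (`AGS.sq_div_four_le_log_one_add`). By Markov's inequality each tail has
probability at most `exp (-cbar ε² / 4) ≤ δ / (2 s)`, and there are `2 s` tails. This half uses the
selection rule only to know that the current treelet has a copy.

Termination. Suppose that every graphlet occurs in `G`. If the loop goes on, some uncovered graphlet
occurs, and any spanning tree of such an occurrence is a treelet copy that spans no covered
graphlet. Hence an optimally
selected treelet has such a copy too, and it keeps one until the next selection, because the covered
set does not change in between (`AGS.IsRun.exists_spans_uncovered`). Each executed iteration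
therefore raises `∑ i, min c_i cbar` with conditional probability bounded below by a constant. As
this sum never exceeds `s * cbar`, the probability of running through the first `n` iterations is
`O(1 / n)`.
-/

namespace AGS

/-! ### Two inequalities for the logarithm -/

/-- The exponent of the upper tail. The substitution `ε = 2y / (1 - y)` turns `1 + ε` into
`(1 + y) / (1 - y)`, and two terms of the series of `artanh y` reduce the claim to a polynomial
inequality on `0 ≤ y ≤ 13/53`, the range corresponding to `0 ≤ ε ≤ 13/20`. -/
lemma sq_div_four_le_log_one_add {ε : ℝ} (h0 : 0 ≤ ε) (h1 : ε ≤ 13 / 20) :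
    ε ^ 2 / 4 ≤ Real.log (1 + ε) - ε / (1 + ε) := by
  obtain ⟨y, hy⟩ : ∃ y, y = ε / (2 + ε) := ⟨_, rfl⟩
  have hy0 : 0 ≤ y := by rw [hy]; positivity
  have hy1 : y ≤ 13 / 53 := by
    rw [hy, div_le_iff₀ (by linarith)]; linarith
  have hε : ε = 2 * y / (1 - y) := by
    have : 2 + ε ≠ 0 := by linarith
    rw [eq_div_iff (by linarith), hy]
    field_simp
    ring
  have hlt : 0 < 1 - y := by linarith
  have hlog := Real.sum_range_le_log_div hy0 (by linarith) 2
  have e1 : 1 + ε = (1 + y) / (1 - y) := by rw [hε]; field_simp; ring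
  have e2 : ε / (1 + ε) = 2 * y / (1 + y) := by rw [e1, hε]; field_simp
  rw [e2, e1, hε]
  simp only [Finset.sum_range_succ, Finset.sum_range_zero] at hlog
  norm_num at hlog
  have key : (2 * y / (1 - y)) ^ 2 / 4 ≤ 2 * (y + y ^ 3 / 3) - 2 * y / (1 + y) := by
    have hpoly : 0 ≤ 3 - 13 * y + 4 * y ^ 2 - 2 * y ^ 3 + 2 * y ^ 4 := by
      nlinarith [sq_nonneg (y - 13 / 53), mul_nonneg hy0 hy0, pow_nonneg hy0 3,
        mul_nonneg (pow_nonneg hy0 2) (sub_nonneg.2 hy1), mul_nonneg hy0 (sub_nonneg.2 hy1),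
        sq_nonneg (y ^ 2)]
    have : 2 * (y + y ^ 3 / 3) - 2 * y / (1 + y) - (2 * y / (1 - y)) ^ 2 / 4
        = y ^ 2 * (3 - 13 * y + 4 * y ^ 2 - 2 * y ^ 3 + 2 * y ^ 4)
          / (3 * (1 + y) * (1 - y) ^ 2) := by
      field_simp
      ring
    have h2 : 0 ≤ y ^ 2 * (3 - 13 * y + 4 * y ^ 2 - 2 * y ^ 3 + 2 * y ^ 4)
          / (3 * (1 + y) * (1 - y) ^ 2) := by positivity
    linarith
  linarith

/-- The exponent of the lower tail, by the substitution `ε = 2y / (1 + y)`. -/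
lemma sq_div_four_le_log_one_sub {ε : ℝ} (h0 : 0 ≤ ε) (h1 : ε < 1) :
    ε ^ 2 / 4 ≤ Real.log (1 - ε) + ε / (1 - ε) := by
  obtain ⟨y, hy⟩ : ∃ y, y = ε / (2 - ε) := ⟨_, rfl⟩
  have hy0 : 0 ≤ y := by rw [hy]; apply div_nonneg <;> linarith
  have hy1 : y < 1 := by
    rw [hy, div_lt_iff₀ (by linarith)]; linarith
  have hε : ε = 2 * y / (1 + y) := by
    have : 2 - ε ≠ 0 := by linarith
    rw [eq_div_iff (by linarith), hy]
    field_simp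
    ring
  have hlt : 0 < 1 - y := by linarith
  have hlog := Real.log_div_le_sum_range_add hy0 hy1 0
  have e1 : 1 - ε = ((1 + y) / (1 - y))⁻¹ := by rw [hε]; field_simp; ring
  have e2 : ε / (1 - ε) = 2 * y / (1 - y) := by rw [e1, hε]; field_simp
  rw [e2, e1, hε, Real.log_inv]
  norm_num at hlog
  have hp : 0 < 1 - y ^ 2 := by nlinarith
  have key : (2 * y / (1 + y)) ^ 2 / 4 ≤ 2 * y / (1 - y) - 2 * (y / (1 - y ^ 2)) := by
    have e3 : 2 * y / (1 - y) - 2 * (y / (1 - y ^ 2)) = 2 * y ^ 2 / (1 - y ^ 2) := by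
      field_simp
      ring
    have e4 : (2 * y / (1 + y)) ^ 2 / 4 = y ^ 2 / (1 + y) ^ 2 := by
      field_simp
      ring
    rw [e3, e4]
    gcongr
    · nlinarith [sq_nonneg y]
    · nlinarith
  linarith

/-! ### Copies of a treelet inside the copies of a graphlet -/

instance (k : ℕ) : Finite (Graphlet k) :=
  inferInstanceAs (Finite (Quotient (graphletSetoid k)))

instance (k : ℕ) : Finite (Treelet k) :=
  inferInstanceAs (Finite (Quotient (treeletSetoid k)))

lemma Graphlet.connected {k : ℕ} (i : Graphlet k) : i.graph.Connected := (Quotient.out i).2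

lemma Treelet.isTree {k : ℕ} (j : Treelet k) : j.graph.IsTree := (Quotient.out j).2

lemma Graphlet.eq_of_iso {k : ℕ} {i i' : Graphlet k} (e : i.graph ≃g i'.graph) : i = i' := by
  have : (graphletSetoid k).r (Quotient.out i) (Quotient.out i') := ⟨e⟩
  exact Quotient.out_equiv_out.1 this

lemma exists_graphlet_iso {k : ℕ} {H : SimpleGraph (Fin k)} (hH : H.Connected) :
    ∃ i : Graphlet k, Nonempty (H ≃g i.graph) := by
  obtain ⟨e⟩ : (graphletSetoid k).r
      (Quotient.out (Quotient.mk (graphletSetoid k) ⟨H, hH⟩)) ⟨H, hH⟩ :=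
    Quotient.mk_out (s := graphletSetoid k) ⟨H, hH⟩
  exact ⟨_, ⟨e.symm⟩⟩

lemma exists_treelet_iso {k : ℕ} {T : SimpleGraph (Fin k)} (hT : T.IsTree) :
    ∃ j : Treelet k, Nonempty (T ≃g j.graph) := by
  obtain ⟨e⟩ : (treeletSetoid k).r
      (Quotient.out (Quotient.mk (treeletSetoid k) ⟨T, hT⟩)) ⟨T, hT⟩ :=
    Quotient.mk_out (s := treeletSetoid k) ⟨T, hT⟩
  exact ⟨_, ⟨e.symm⟩⟩

lemma exists_sigma_pos {k : ℕ} (i : Graphlet k) : ∃ j : Treelet k, 0 < sigma i j := by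
  obtain ⟨T, hle, hT⟩ := i.connected.exists_isTree_le
  obtain ⟨j, hj⟩ := exists_treelet_iso hT
  exact ⟨j, (Set.ncard_pos (Set.toFinite _)).2 ⟨T, hle, hj⟩⟩

section Copies

variable {k : ℕ} {V : Type*} {G : SimpleGraph V} {col : V → Fin k}

lemma Spans.unique {x : G.Subgraph} {i i' : Graphlet k} (h : Spans x i) (h' : Spans x i') :
    i = i' := by
  obtain ⟨e⟩ := h
  obtain ⟨e'⟩ := h'
  exact Graphlet.eq_of_iso (e.symm.trans e')

lemma exists_spans {j : Treelet k} {x : G.Subgraph} (hx : x ∈ treeletCopies G col j) :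
    ∃ i : Graphlet k, Spans x i := by
  obtain ⟨-, ⟨e⟩⟩ := hx
  have hconn : (G.induce x.verts).Connected := by
    have h : x.coe.Connected := e.connected_iff.2 j.isTree.1
    exact h.mono fun u v huv => x.adj_sub huv
  let f : x.verts ≃ Fin k := e.toEquiv
  have g : G.induce x.verts ≃g (G.induce x.verts).map f.toEmbedding :=
    SimpleGraph.Iso.map f _
  obtain ⟨i, ⟨h⟩⟩ := exists_graphlet_iso (g.connected_iff.1 hconn)
  exact ⟨i, ⟨g.trans h⟩⟩

/-- The subgraph of `G` with node set `S` whose edges are those of `T`, read through a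
numbering `e` of the nodes of `S`. -/
def pullSubgraph {S : Set V} {H : SimpleGraph (Fin k)} (e : G.induce S ≃g H)
    (T : SimpleGraph (Fin k)) (hT : T ≤ H) : G.Subgraph where
  verts := S
  Adj u v := ∃ hu : u ∈ S, ∃ hv : v ∈ S, T.Adj (e ⟨u, hu⟩) (e ⟨v, hv⟩)
  adj_sub := by
    rintro u v ⟨hu, hv, h⟩
    have := e.map_adj_iff.1 (hT h)
    exact this
  edge_vert := fun ⟨hu, _, _⟩ => hu
  symm := ⟨fun _ _ ⟨hu, hv, h⟩ => ⟨hv, hu, h.symm⟩⟩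

/-- A copy of `H` in `G` contains as many copies of `T_j` on its node set as `H` has spanning trees
isomorphic to `T_j`. -/
lemma ncard_copies_on {i : Graphlet k} (j : Treelet k) {S : Set V} (e : G.induce S ≃g i.graph) :
    {x : G.Subgraph | x.verts = S ∧ Nonempty (x.coe ≃g j.graph)}.ncard = sigma i j := by
  symm
  refine Set.ncard_congr (fun T hT => pullSubgraph e T hT.1) ?_ ?_ ?_
  · rintro T ⟨hT, ⟨f⟩⟩
    refine ⟨rfl, ⟨RelIso.trans ⟨e.toEquiv, ?_⟩ f⟩⟩
    rintro ⟨u, hu⟩ ⟨v, hv⟩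
    exact ⟨fun h => ⟨hu, hv, h⟩, fun h => h.elim fun _ h => h.elim fun _ h => h⟩
  · intro T T' _ _ h
    ext a b
    have := congrArg (fun x : G.Subgraph => x.Adj (e.symm a) (e.symm b)) h
    simpa [pullSubgraph] using this
  · rintro x ⟨rfl, ⟨f⟩⟩
    have hle : x.coe.map e.toEquiv.toEmbedding ≤ i.graph := by
      rw [SimpleGraph.map_le_iff_le_comap]
      intro u v huv
      exact e.map_adj_iff.2 (x.adj_sub huv)
    refine ⟨x.coe.map e.toEquiv.toEmbedding,
      ⟨hle, ⟨(SimpleGraph.Iso.map e.toEquiv x.coe).symm.trans f⟩⟩, ?_⟩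
    have hadj : ∀ u v : x.verts, (x.coe.map e.toEquiv.toEmbedding).Adj (e u) (e v) ↔ x.Adj u v :=
      fun u v => SimpleGraph.map_adj_apply (f := e.toEquiv.toEmbedding)
    ext u v
    · rfl
    · constructor
      · rintro ⟨hu, hv, h⟩
        exact (hadj ⟨u, hu⟩ ⟨v, hv⟩).1 h
      · intro h
        exact ⟨x.edge_vert h, x.edge_vert h.symm, (hadj ⟨u, _⟩ ⟨v, _⟩).2 h⟩

/-- Double counting: `T_j` has `g_i σ_{ij}` colorful copies that span a copy of `H_i`. -/
lemma ncard_copies_spanning [Finite V] (i : Graphlet k) (j : Treelet k) :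
    {x | x ∈ treeletCopies G col j ∧ Spans x i}.ncard = graphletCount G col i * sigma i j := by
  classical
  have := Fintype.ofFinite G.Subgraph
  have := Fintype.ofFinite (Set V)
  rw [graphletCount, Set.ncard_eq_toFinset_card', Set.ncard_eq_toFinset_card',
    Finset.card_eq_sum_card_fiberwise (f := fun x : G.Subgraph => x.verts)
      (t := (graphletCopies G col i).toFinset)]
  · refine Finset.sum_const_nat fun S hS => ?_
    obtain ⟨hinj, ⟨e⟩⟩ := Set.mem_toFinset.1 hS
    rw [← ncard_copies_on j e, Set.ncard_eq_toFinset_card']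
    congr 1
    ext x
    simp only [Finset.mem_filter, Set.mem_toFinset, Set.mem_ofPred_eq]
    constructor
    · rintro ⟨⟨⟨_, h⟩, _⟩, h'⟩
      exact ⟨h', h⟩
    · rintro ⟨rfl, h⟩
      exact ⟨⟨⟨hinj, h⟩, ⟨e⟩⟩, rfl⟩
  · intro x hx
    rw [Set.coe_toFinset] at hx ⊢
    exact ⟨hx.1.1, hx.2⟩

end Copies

/-! ### Pathwise facts about a run -/

section Path

variable {k : ℕ} {V : Type*} {G : SimpleGraph V} {col : V → Fin k} {Ω : Type*}
  {J : ℕ → Ω → Treelet k} {X : ℕ → Ω → G.Subgraph} {cbar : ℕ}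

open Classical in
lemma count_succ (i : Graphlet k) (t : ℕ) (ω : Ω) :
    count X i (t + 1) ω = count X i t ω + if Spans (X t ω) i then 1 else 0 :=
  Finset.sum_range_succ _ _

lemma count_mono (i : Graphlet k) (ω : Ω) : Monotone fun t => count X i t ω :=
  monotone_nat_of_le_succ fun t => by rw [count_succ]; exact Nat.le_add_right _ _

lemma covered_mono (ω : Ω) :
    Monotone fun t => (covered X cbar t ω : Set (Graphlet k)) :=
  fun _ _ h i hi => le_trans hi (count_mono i ω h)

lemma Running.anti {s t : ℕ} {ω : Ω} (h : Running k X cbar t ω) (hst : s ≤ t) :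
    Running k X cbar s ω := by
  intro hs
  apply h
  rw [← Set.univ_subset_iff, ← hs]
  exact covered_mono ω hst

lemma exists_stopsAt {ω : Ω} (h : ∃ t, ¬ Running k X cbar t ω) :
    ∃ t, StopsAt k X cbar t ω := by
  classical
  exact ⟨Nat.find h, Nat.find_spec h, fun u hu => not_not.1 (Nat.find_min h hu)⟩

lemma StopsAt.le_count {t : ℕ} {ω : Ω} (h : StopsAt k X cbar t ω) (i : Graphlet k) :
    cbar ≤ count X i t ω := by
  have : i ∈ (covered X cbar t ω : Set (Graphlet k)) := by
    rw [not_not.1 h.1]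
    trivial
  exact this

/-- Iteration `t` is executed and its draw spans a graphlet not covered before. -/
def Progress (X : ℕ → Ω → G.Subgraph) (k cbar t : ℕ) : Set Ω :=
  {ω | Running k X cbar t ω ∧
    ∃ i ∉ (covered X cbar t ω : Set (Graphlet k)), Spans (X t ω) i}

/-- Each progress step raises the potential `∑ i, min c_i cbar`, so there are at most `s * cbar`
of them. -/
lemma sum_indicator_progress_le (n : ℕ) (ω : Ω) :
    ∑ t ∈ Finset.range n, (Progress X k cbar t).indicator 1 ω ≤ numGraphlets k * cbar := by
  classical
  have := Fintype.ofFinite (Graphlet k)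
  have hpot : ∑ t ∈ Finset.range n, (Progress X k cbar t).indicator (1 : Ω → ℕ) ω ≤
      ∑ i : Graphlet k, min (count X i n ω) cbar := by
    induction n with
    | zero => simp
    | succ n ih =>
      rw [Finset.sum_range_succ]
      have hle : ∀ i ∈ (Finset.univ : Finset (Graphlet k)), min (count X i n ω) cbar ≤
          min (count X i (n + 1) ω) cbar :=
        fun i _ => min_le_min_right _ (count_mono i ω n.le_succ)
      by_cases hω : ω ∈ Progress X k cbar n
      · rw [Set.indicator_of_mem hω]
        obtain ⟨_, i, hi, hs⟩ := hω
        have hi' : count X i n ω < cbar := not_le.1 hi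
        refine (Nat.succ_le_succ ih).trans
          (Nat.succ_le_of_lt (Finset.sum_lt_sum hle ⟨i, Finset.mem_univ i, ?_⟩))
        rw [count_succ, if_pos hs]
        omega
      · rw [Set.indicator_of_notMem hω, add_zero]
        exact ih.trans (Finset.sum_le_sum hle)
  refine hpot.trans ?_
  rw [numGraphlets, Nat.card_eq_fintype_card, ← Finset.card_univ (α := Graphlet k), ← smul_eq_mul]
  exact Finset.sum_le_card_nsmul _ _ _ fun i _ => min_le_right _ _

end Path

/-! ### The exponential process -/

section Tilt

open scoped ENNReal

variable {k : ℕ} {V : Type*} {G : SimpleGraph V} {col : V → Fin k} {Ω : Type*}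
  {J : ℕ → Ω → Treelet k} {X : ℕ → Ω → G.Subgraph} {cbar : ℕ}

/-- The factor by which the exponential process for `H_i` with parameter `r` changes when `T_j` is
sampled and `x` is drawn: `1 + r` if `x` spans `H_i`, and in either case the compensator
`exp (-r p)`, where `p = g_i σ_{ij} / t_j` is the probability of spanning `H_i`. -/
noncomputable def tiltFactor (G : SimpleGraph V) (col : V → Fin k) (r : ℝ) (i : Graphlet k)
    (j : Treelet k) (x : G.Subgraph) : ℝ :=
  open Classical in
  (if Spans x i then 1 + r else 1) *
    Real.exp (-r * (graphletCount G col i * ((sigma i j : ℝ) / treeletCount G col j)))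

/-- The process `(1 + r) ^ {c_i} exp (-r g_i w_i)`, frozen when the algorithm stops. -/
noncomputable def tilt (col : V → Fin k) (J : ℕ → Ω → Treelet k) (X : ℕ → Ω → G.Subgraph)
    (cbar : ℕ) (r : ℝ) (i : Graphlet k) (t : ℕ) (ω : Ω) : ℝ≥0∞ :=
  open Classical in
  ∏ u ∈ Finset.range t,
    if Running k X cbar u ω then ENNReal.ofReal (tiltFactor G col r i (J u ω) (X u ω)) else 1

lemma tiltFactor_nonneg {r : ℝ} (hr : -1 < r) (i : Graphlet k) (j : Treelet k) (x : G.Subgraph) :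
    0 ≤ tiltFactor G col r i j x := by
  unfold tiltFactor
  have : 0 ≤ 1 + r := by linarith
  split_ifs <;> positivity

lemma tilt_succ (r : ℝ) (i : Graphlet k) (t : ℕ) (ω : Ω) [Decidable (Running k X cbar t ω)] :
    tilt col J X cbar r i (t + 1) ω = tilt col J X cbar r i t ω *
      if Running k X cbar t ω then ENNReal.ofReal (tiltFactor G col r i (J t ω) (X t ω))
      else 1 := by
  unfold tilt
  rw [Finset.prod_range_succ]
  congr!

lemma tilt_eq_of_running {r : ℝ} (hr : -1 < r) (i : Graphlet k) {t : ℕ} {ω : Ω}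
    (h : ∀ u < t, Running k X cbar u ω) :
    tilt col J X cbar r i t ω = ENNReal.ofReal ((1 + r) ^ count X i t ω *
      Real.exp (-r * (graphletCount G col i * weight G col J i t ω))) := by
  classical
  induction t with
  | zero => simp [tilt, count, weight]
  | succ t ih =>
    rw [tilt_succ, if_pos (h t t.lt_succ_self), ih fun u hu => h u (hu.trans t.lt_succ_self),
      ← ENNReal.ofReal_mul (by have : 0 < 1 + r := by linarith
                               positivity), count_succ]
    have hw : weight G col J i (t + 1) ω = weight G col J i t ω +
        (sigma i (J t ω) : ℝ) / treeletCount G col (J t ω) := Finset.sum_range_succ _ _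
    rw [hw, tiltFactor, mul_add, mul_add, Real.exp_add]
    congr 1
    split_ifs <;> ring

lemma tilt_eq_of_stopsAt (r : ℝ) (i : Graphlet k) {t n : ℕ} {ω : Ω}
    (h : StopsAt k X cbar t ω) (htn : t ≤ n) :
    tilt col J X cbar r i n ω = tilt col J X cbar r i t ω := by
  classical
  induction n, htn using Nat.le_induction with
  | base => rfl
  | succ n hn ih => rw [tilt_succ, if_neg fun hR => h.1 (hR.anti hn), mul_one, ih]

end Tilt

section Run

variable {k : ℕ} {V : Type*} {G : SimpleGraph V} {col : V → Fin k} {Ω : Type*}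
  [MeasurableSpace Ω] {μ : Measure Ω} {ℱ : Filtration ℕ ‹MeasurableSpace Ω›}
  {J : ℕ → Ω → Treelet k} {X : ℕ → Ω → G.Subgraph} {cbar : ℕ}

/-- While the algorithm runs, the current treelet can be sampled: it is either the initial one, or
kept, or selected by a rule that admits only treelets with a copy. -/
lemma IsRun.treeletCount_pos (hrun : IsRun col J X cbar μ ℱ)
    (hopt : SwitchesOptimally col J X cbar) {t : ℕ} {ω : Ω} (h : Running k X cbar t ω) :
    0 < treeletCount G col (J t ω) := by
  induction t with
  | zero => exact hrun.initial ω
  | succ t ih =>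
    have ht : Running k X cbar t ω := h.anti t.le_succ
    by_cases hc : ∀ i : Graphlet k, Spans (X t ω) i → count X i (t + 1) ω < cbar
    · rw [hrun.keep t ω ht hc]
      exact ih ht
    · push Not at hc
      obtain ⟨i, hi, hi'⟩ := hc
      exact (hopt t ω ht i hi hi').1

/-! ### Measurability -/

lemma measurableSet_of_fibers {α β : Type*} [Finite α] {m : MeasurableSpace β} {Y : β → α}
    (hY : ∀ a, MeasurableSet[m] {b | Y b = a}) (P : α → Prop) :
    MeasurableSet[m] {b | P (Y b)} := by
  have : {b | P (Y b)} = ⋃ a : {a // P a}, {b | Y b = a} := by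
    ext b
    simp
  rw [this]
  exact MeasurableSet.iUnion fun a => hY a

lemma measurable_of_fibers {α β γ : Type*} [Finite α] {m : MeasurableSpace β}
    [MeasurableSpace γ] {Y : β → α} (hY : ∀ a, MeasurableSet[m] {b | Y b = a}) (f : α → γ) :
    Measurable[m] fun b => f (Y b) :=
  fun s _ => measurableSet_of_fibers hY fun a => f a ∈ s

variable [Finite V]

lemma IsRun.measurable_count (hrun : IsRun col J X cbar μ ℱ) (i : Graphlet k) (t : ℕ) :
    Measurable[ℱ t] (count X i t) := by
  classical
  have h : ∀ u ∈ Finset.range t, Measurable[ℱ t] fun ω => if Spans (X u ω) i then 1 else 0 := by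
    intro u hu
    refine Measurable.mono (measurable_of_fibers (hrun.adapted_X u)
      fun x => if Spans x i then 1 else 0) (ℱ.mono (Finset.mem_range.1 hu)) le_rfl
  exact Finset.measurable_fun_sum _ h

lemma IsRun.measurableSet_covered (hrun : IsRun col J X cbar μ ℱ) (t : ℕ)
    (C : Set (Graphlet k)) : MeasurableSet[ℱ t] {ω | covered X cbar t ω = C} := by
  have : {ω | covered X cbar t ω = C} = ⋂ i : Graphlet k, {ω | cbar ≤ count X i t ω ↔ i ∈ C} := by
    ext ω
    simp [covered, Set.ext_iff]
  rw [this]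
  exact MeasurableSet.iInter fun i => hrun.measurable_count i t
    (MeasurableSet.of_discrete (s := {n | cbar ≤ n ↔ i ∈ C}))

lemma IsRun.measurableSet_running (hrun : IsRun col J X cbar μ ℱ) (t : ℕ) :
    MeasurableSet[ℱ t] {ω | Running k X cbar t ω} :=
  (hrun.measurableSet_covered t Set.univ).compl

/-! ### One draw -/

open scoped ENNReal

/-- The conditional law of a draw, in integrated form: if `T_j` is sampled on the event `A` of the
past, then on `A` the draw averages `φ` over the copies of `T_j`, also when weighted by a
function `f` of the past. -/
lemma IsRun.lintegral_draw [IsFiniteMeasure μ] (hrun : IsRun col J X cbar μ ℱ) {t : ℕ}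
    {j : Treelet k} (hj : 0 < treeletCount G col j) {A : Set Ω} (hA : MeasurableSet[ℱ t] A)
    (hAj : ∀ ω ∈ A, Running k X cbar t ω ∧ J t ω = j) {f : Ω → ℝ≥0∞} (hf : Measurable[ℱ t] f)
    (φ : G.Subgraph → ℝ≥0∞) :
    ∫⁻ ω in A, f ω * φ (X t ω) ∂μ =
      (∫⁻ ω in A, f ω ∂μ) *
        ((∑ x ∈ (Set.toFinite (treeletCopies G col j)).toFinset, φ x) /
          (treeletCount G col j : ℝ≥0∞)) := by
  classical
  have := Fintype.ofFinite G.Subgraph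
  set n : ℝ≥0∞ := (treeletCount G col j : ℝ≥0∞) with hn
  have hn0 : n ≠ 0 := by rw [hn]; exact_mod_cast hj.ne'
  have hnt : n ≠ ∞ := ENNReal.natCast_ne_top _
  set K := (Set.toFinite (treeletCopies G col j)).toFinset with hK
  have hKn : (K.card : ℝ≥0∞) = n := by
    rw [hK, hn, treeletCount, Set.ncard_eq_toFinset_card _ (Set.toFinite _)]
  have hA' : MeasurableSet A := ℱ.le t _ hA
  have hX : ∀ x, MeasurableSet {ω | X t ω = x} := fun x => ℱ.le _ _ (hrun.adapted_X t x)
  have hU : A = ⋃ x, A ∩ {ω | X t ω = x} := by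
    ext ω
    simp
  have hdisj : Pairwise (Function.onFun Disjoint fun x => A ∩ {ω | X t ω = x}) := by
    intro x y hxy
    refine Set.disjoint_left.2 ?_
    rintro ω ⟨_, h⟩ ⟨_, h'⟩
    exact hxy (h.symm.trans h')
  -- The copies of `T_j` exhaust the mass of `A`, so no other subgraph is drawn.
  have hnull : ∀ x ∉ K, μ (A ∩ {ω | X t ω = x}) = 0 := by
    have hsum : μ A = ∑ x, μ (A ∩ {ω | X t ω = x}) := by
      conv_lhs => rw [hU]
      rw [measure_iUnion hdisj fun x => hA'.inter (hX x), tsum_fintype]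
    have hin : ∑ x ∈ K, μ (A ∩ {ω | X t ω = x}) = μ A := by
      rw [Finset.sum_congr rfl fun x hx => hrun.uniform t j x (by simpa [hK] using hx) A hA hAj,
        Finset.sum_const, nsmul_eq_mul, hKn, ENNReal.mul_div_cancel hn0 hnt]
    rw [← Finset.sum_add_sum_compl K, hin] at hsum
    have h0 : ∑ x ∈ Kᶜ, μ (A ∩ {ω | X t ω = x}) = 0 := by
      have := ENNReal.add_right_inj (measure_ne_top μ A) (b := 0)
        (c := ∑ x ∈ Kᶜ, μ (A ∩ {ω | X t ω = x}))
      rw [add_zero] at this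
      exact (this.1 hsum).symm
    intro x hx
    exact Finset.sum_eq_zero_iff.1 h0 x (Finset.mem_compl.2 hx)
  -- A single draw is independent of the past up to the constant factor `1 / t_j`.
  have hpiece : ∀ x ∈ K, ∫⁻ ω in A ∩ {ω | X t ω = x}, f ω ∂μ = (∫⁻ ω in A, f ω ∂μ) / n := by
    intro x hx
    have hle := ℱ.le t
    have htrim : (μ.restrict (A ∩ {ω | X t ω = x})).trim hle = n⁻¹ • (μ.restrict A).trim hle := by
      refine @Measure.ext _ (ℱ t) _ _ fun B hB => ?_
      rw [trim_measurableSet_eq hle hB, Measure.smul_apply, trim_measurableSet_eq hle hB,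
        Measure.restrict_apply (hle _ hB), Measure.restrict_apply (hle _ hB), ← Set.inter_assoc,
        hrun.uniform t j x (by simpa [hK] using hx) (B ∩ A) (hB.inter hA)
          fun ω hω => hAj ω hω.2, smul_eq_mul, mul_comm, ENNReal.div_eq_inv_mul, mul_comm]
    rw [← lintegral_trim hle hf, htrim, lintegral_smul_measure, lintegral_trim hle hf,
      smul_eq_mul, mul_comm, div_eq_mul_inv]
  have hvalue : ∀ x, ∫⁻ ω in A ∩ {ω | X t ω = x}, f ω * φ (X t ω) ∂μ =
      (∫⁻ ω in A ∩ {ω | X t ω = x}, f ω ∂μ) * φ x := by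
    intro x
    rw [← lintegral_mul_const _ (hf.mono (ℱ.le t) le_rfl)]
    refine setLIntegral_congr_fun (hA'.inter (hX x)) fun ω hω => ?_
    have : X t ω = x := hω.2
    simp [this]
  calc ∫⁻ ω in A, f ω * φ (X t ω) ∂μ
      = ∑ x, ∫⁻ ω in A ∩ {ω | X t ω = x}, f ω * φ (X t ω) ∂μ := by
        conv_lhs => rw [hU]
        rw [lintegral_iUnion (fun x => hA'.inter (hX x)) hdisj, tsum_fintype]
    _ = ∑ x ∈ K, ∫⁻ ω in A ∩ {ω | X t ω = x}, f ω * φ (X t ω) ∂μ := by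
        refine (Finset.sum_subset (Finset.subset_univ K) fun x _ hx => ?_).symm
        exact setLIntegral_measure_zero _ _ (hnull x hx)
    _ = ∑ x ∈ K, (∫⁻ ω in A, f ω ∂μ) * (φ x / n) := by
        refine Finset.sum_congr rfl fun x hx => ?_
        rw [hvalue, hpiece x hx, div_eq_mul_inv, div_eq_mul_inv, mul_assoc, mul_comm n⁻¹]
    _ = _ := by
        simp only [div_eq_mul_inv]
        rw [← Finset.mul_sum, Finset.sum_mul]

/-! ### The exponential process is a supermartingale -/

/-- On average over the copies of `T_j`, the factor is `(1 + r p) exp (-r p) ≤ 1`. -/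
lemma sum_tiltFactor_le (r : ℝ) (i : Graphlet k) {j : Treelet k}
    (hj : 0 < treeletCount G col j) :
    ∑ x ∈ (Set.toFinite (treeletCopies G col j)).toFinset, tiltFactor G col r i j x ≤
      treeletCount G col j := by
  classical
  set n := treeletCount G col j
  set K := (Set.toFinite (treeletCopies G col j)).toFinset with hK
  have hKn : K.card = n := (Set.ncard_eq_toFinset_card _ (Set.toFinite _)).symm
  have hs : (K.filter fun x => Spans x i).card = graphletCount G col i * sigma i j := by
    rw [← ncard_copies_spanning, ← Set.ncard_coe_finset]
    congr 1
    ext x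
    simp [hK]
  have hn : (0 : ℝ) < n := by exact_mod_cast hj
  set q : ℝ := graphletCount G col i * ((sigma i j : ℝ) / n) with hq
  have hsum : ∑ x ∈ K, tiltFactor G col r i j x = n * ((1 + r * q) * Real.exp (-r * q)) := by
    have h1 : ∀ x : G.Subgraph, (if Spans x i then 1 + r else 1) =
        1 + r * (if Spans x i then (1 : ℝ) else 0) := by
      intro x
      split_ifs <;> simp
    unfold tiltFactor
    rw [← Finset.sum_mul]
    simp only [h1]
    rw [Finset.sum_add_distrib, ← Finset.mul_sum, Finset.sum_boole, hs, Finset.sum_const, hKn,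
      nsmul_eq_mul]
    change _ * Real.exp (-r * q) = _
    rw [← mul_assoc (n : ℝ)]
    congr 1
    rw [hq]
    push_cast
    field_simp
  rw [hsum]
  refine mul_le_of_le_one_right hn.le ?_
  calc (1 + r * q) * Real.exp (-r * q) ≤ Real.exp (r * q) * Real.exp (-r * q) := by
        gcongr
        linarith [Real.add_one_le_exp (r * q)]
    _ = 1 := by rw [← Real.exp_add]; simp

lemma IsRun.measurable_tilt (hrun : IsRun col J X cbar μ ℱ) (r : ℝ) (i : Graphlet k) (t : ℕ) :
    Measurable[ℱ t] (tilt col J X cbar r i t) := by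
  classical
  unfold tilt
  refine Finset.measurable_fun_prod _ fun u hu => ?_
  have hut : u + 1 ≤ t := Finset.mem_range.1 hu
  refine Measurable.ite (ℱ.mono (u.le_succ.trans hut) _ (hrun.measurableSet_running u)) ?_
    measurable_const
  have hY : ∀ a : Treelet k × G.Subgraph,
      MeasurableSet[ℱ t] {ω | (J u ω, X u ω) = a} := by
    rintro ⟨j, x⟩
    have : {ω | (J u ω, X u ω) = (j, x)} = {ω | J u ω = j} ∩ {ω | X u ω = x} := by
      ext ω
      simp
    rw [this]
    exact (ℱ.mono (u.le_succ.trans hut) _ (hrun.adapted_J u j)).inter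
      (ℱ.mono hut _ (hrun.adapted_X u x))
  exact measurable_of_fibers hY fun a => ENNReal.ofReal (tiltFactor G col r i a.1 a.2)

lemma IsRun.lintegral_tilt_le_one [IsProbabilityMeasure μ] (hrun : IsRun col J X cbar μ ℱ)
    (hopt : SwitchesOptimally col J X cbar) {r : ℝ} (hr : -1 < r) (i : Graphlet k) (t : ℕ) :
    ∫⁻ ω, tilt col J X cbar r i t ω ∂μ ≤ 1 := by
  classical
  induction t with
  | zero => simp [tilt]
  | succ t ih =>
    refine le_trans ?_ ih
    have hR : MeasurableSet {ω | Running k X cbar t ω} :=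
      ℱ.le t _ (hrun.measurableSet_running t)
    have hJ : ∀ j, MeasurableSet[ℱ t] ({ω | Running k X cbar t ω} ∩ {ω | J t ω = j}) :=
      fun j => (hrun.measurableSet_running t).inter (hrun.adapted_J t j)
    rw [← lintegral_add_compl _ hR, ← lintegral_add_compl (tilt col J X cbar r i t) hR]
    refine add_le_add ?_ (setLIntegral_mono' hR.compl fun ω hω => ?_)
    · have hU : {ω | Running k X cbar t ω} =
          ⋃ j, {ω | Running k X cbar t ω} ∩ {ω | J t ω = j} := by
        ext ω
        simp
      have hdisj : Pairwise (Function.onFun Disjoint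
          fun j => {ω | Running k X cbar t ω} ∩ {ω | J t ω = j}) := by
        intro x y hxy
        refine Set.disjoint_left.2 ?_
        rintro ω ⟨_, h⟩ ⟨_, h'⟩
        exact hxy (h.symm.trans h')
      rw [hU, lintegral_iUnion (fun j => ℱ.le t _ (hJ j)) hdisj,
        lintegral_iUnion (fun j => ℱ.le t _ (hJ j)) hdisj]
      refine ENNReal.tsum_le_tsum fun j => ?_
      rcases Set.eq_empty_or_nonempty ({ω | Running k X cbar t ω} ∩ {ω | J t ω = j}) with h | h
      · simp [h]
      obtain ⟨ω₀, h₀, rfl⟩ := h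
      have hj := hrun.treeletCount_pos hopt h₀
      calc _ = ∫⁻ ω in {ω | Running k X cbar t ω} ∩ {ω | J t ω = J t ω₀},
              tilt col J X cbar r i t ω *
                ENNReal.ofReal (tiltFactor G col r i (J t ω₀) (X t ω)) ∂μ := by
            refine setLIntegral_congr_fun (ℱ.le t _ (hJ _)) fun ω hω => ?_
            have h1 : Running k X cbar t ω := hω.1
            have h2 : J t ω = J t ω₀ := hω.2
            rw [tilt_succ, if_pos h1, h2]
        _ = (∫⁻ ω in {ω | Running k X cbar t ω} ∩ {ω | J t ω = J t ω₀},
              tilt col J X cbar r i t ω ∂μ) * _ :=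
            hrun.lintegral_draw hj (hJ _) (fun ω hω => hω) (hrun.measurable_tilt r i t)
              fun x => ENNReal.ofReal (tiltFactor G col r i (J t ω₀) x)
        _ ≤ _ := by
            refine mul_le_of_le_one_right' (ENNReal.div_le_of_le_mul ?_)
            rw [← ENNReal.ofReal_sum_of_nonneg fun x _ => tiltFactor_nonneg hr _ _ _, one_mul,
              ← ENNReal.ofReal_natCast]
            exact ENNReal.ofReal_le_ofReal (sum_tiltFactor_le r i hj)
    · have h1 : ¬ Running k X cbar t ω := hω
      rw [tilt_succ, if_neg h1, mul_one]

/-- Markov's inequality for the stopped process. No maximal inequality is needed, since the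
process is frozen at the stopping time. -/
lemma IsRun.measure_le_tilt_le [IsProbabilityMeasure μ] (hrun : IsRun col J X cbar μ ℱ)
    (hopt : SwitchesOptimally col J X cbar) {r : ℝ} (hr : -1 < r) (i : Graphlet k) (a : ℝ≥0∞) :
    μ {ω | ∃ t, StopsAt k X cbar t ω ∧ a ≤ tilt col J X cbar r i t ω} ≤ a⁻¹ := by
  have hmono : Monotone fun n =>
      {ω | ∃ t ≤ n, StopsAt k X cbar t ω ∧ a ≤ tilt col J X cbar r i t ω} := by
    rintro m n hmn ω ⟨t, ht, h⟩
    exact ⟨t, ht.trans hmn, h⟩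
  have hU : {ω | ∃ t, StopsAt k X cbar t ω ∧ a ≤ tilt col J X cbar r i t ω} =
      ⋃ n, {ω | ∃ t ≤ n, StopsAt k X cbar t ω ∧ a ≤ tilt col J X cbar r i t ω} := by
    ext ω
    simp only [Set.mem_ofPred_eq, Set.mem_iUnion]
    exact ⟨fun ⟨t, h⟩ => ⟨t, t, le_rfl, h⟩, fun ⟨_, t, _, h⟩ => ⟨t, h⟩⟩
  rw [hU, hmono.measure_iUnion]
  refine iSup_le fun n => ?_
  have hmarkov := mul_meas_ge_le_lintegral (μ := μ)
    ((hrun.measurable_tilt r i n).mono (ℱ.le n) le_rfl) a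
  refine (measure_mono ?_).trans
    ((ENNReal.le_inv_iff_mul_le).2 <|
      (mul_comm _ _).le.trans (hmarkov.trans (hrun.lintegral_tilt_le_one hopt hr i n)))
  rintro ω ⟨t, ht, hs, hle⟩
  exact hle.trans (tilt_eq_of_stopsAt r i hs ht).ge

end Run

/-! ### Tail bounds at the stopping time -/

section Tails

variable {k : ℕ} {V : Type*} {G : SimpleGraph V} {col : V → Fin k} {Ω : Type*}
  [MeasurableSpace Ω] {μ : Measure Ω} {ℱ : Filtration ℕ ‹MeasurableSpace Ω›}
  {J : ℕ → Ω → Treelet k} {X : ℕ → Ω → G.Subgraph} {cbar : ℕ} [Finite V]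

open scoped ENNReal

/-- If a deviation event forces the logarithm of the exponential process to be at least `cbar * κ`
at the stopping time, its probability is at most `exp (-cbar κ)`. -/
lemma IsRun.measure_deviation_le [IsProbabilityMeasure μ] (hrun : IsRun col J X cbar μ ℱ)
    (hopt : SwitchesOptimally col J X cbar) {r κ : ℝ} (hr : -1 < r) (hκ : 0 ≤ κ)
    (i : Graphlet k) {P : ℝ → ℝ → Prop}
    (hP : ∀ c y : ℝ, 0 ≤ c → P c y → c * κ ≤ c * Real.log (1 + r) - r * y) :
    μ {ω | ∃ t, StopsAt k X cbar t ω ∧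
        P (count X i t ω) (graphletCount G col i * weight G col J i t ω)} ≤
      ENNReal.ofReal (Real.exp (-(cbar * κ))) := by
  rw [Real.exp_neg, ENNReal.ofReal_inv_of_pos (Real.exp_pos _)]
  refine (measure_mono ?_).trans (hrun.measure_le_tilt_le hopt hr i _)
  rintro ω ⟨t, hs, h⟩
  refine ⟨t, hs, ?_⟩
  rw [tilt_eq_of_running hr i hs.2]
  refine ENNReal.ofReal_le_ofReal ?_
  have hr' : 0 < 1 + r := by linarith
  have hc : (cbar : ℝ) ≤ count X i t ω := by exact_mod_cast hs.le_count i
  rw [← Real.rpow_natCast, Real.rpow_def_of_pos hr', ← Real.exp_add]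
  refine Real.exp_le_exp.2 ?_
  have h1 := hP _ _ (Nat.cast_nonneg _) h
  have h2 : cbar * κ ≤ count X i t ω * κ := mul_le_mul_of_nonneg_right hc hκ
  linarith

lemma IsRun.measure_upper_le [IsProbabilityMeasure μ] (hrun : IsRun col J X cbar μ ℱ)
    (hopt : SwitchesOptimally col J X cbar) {ε : ℝ} (h0 : 0 < ε) (h1 : ε ≤ 13 / 20)
    (i : Graphlet k) :
    μ {ω | ∃ t, StopsAt k X cbar t ω ∧
        (1 + ε) * (graphletCount G col i * weight G col J i t ω) < count X i t ω} ≤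
      ENNReal.ofReal (Real.exp (-(cbar * (ε ^ 2 / 4)))) := by
  refine hrun.measure_deviation_le hopt (r := ε) (P := fun c y => (1 + ε) * y < c) (by linarith)
    (by positivity) i fun c y hc h => ?_
  have hy : y ≤ c / (1 + ε) := by
    rw [le_div_iff₀ (by linarith)]
    linarith
  calc c * (ε ^ 2 / 4) ≤ c * (Real.log (1 + ε) - ε / (1 + ε)) := by
        gcongr
        exact sq_div_four_le_log_one_add h0.le h1
    _ = c * Real.log (1 + ε) - ε * (c / (1 + ε)) := by ring
    _ ≤ c * Real.log (1 + ε) - ε * y := by gcongr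

lemma IsRun.measure_lower_le [IsProbabilityMeasure μ] (hrun : IsRun col J X cbar μ ℱ)
    (hopt : SwitchesOptimally col J X cbar) {ε : ℝ} (h0 : 0 < ε) (h1 : ε < 1)
    (i : Graphlet k) :
    μ {ω | ∃ t, StopsAt k X cbar t ω ∧
        count X i t ω < (1 - ε) * (graphletCount G col i * weight G col J i t ω)} ≤
      ENNReal.ofReal (Real.exp (-(cbar * (ε ^ 2 / 4)))) := by
  refine hrun.measure_deviation_le hopt (r := -ε) (P := fun c y => c < (1 - ε) * y) (by linarith)
    (by positivity) i fun c y hc h => ?_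
  have hy : c / (1 - ε) ≤ y := by
    rw [div_le_iff₀ (by linarith)]
    linarith
  calc c * (ε ^ 2 / 4) ≤ c * (Real.log (1 - ε) + ε / (1 - ε)) := by
        gcongr
        exact sq_div_four_le_log_one_sub h0.le h1
    _ = c * Real.log (1 - ε) + ε * (c / (1 - ε)) := by ring
    _ ≤ c * Real.log (1 - ε) + ε * y := by gcongr
    _ = c * Real.log (1 + -ε) - -ε * y := by rw [← sub_eq_add_neg]; ring

end Tails

lemma nonempty_graphlet {k : ℕ} (j : Treelet k) : Nonempty (Graphlet k) :=
  (exists_graphlet_iso j.isTree.1).nonempty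

lemma numGraphlets_pos {k : ℕ} (j : Treelet k) : 0 < numGraphlets k :=
  have := nonempty_graphlet j
  Nat.card_pos

lemma exp_neg_threshold_le {k : ℕ} (hs : 0 < numGraphlets k) {ε δ : ℝ} (hε : 0 < ε)
    (hδ : 0 < δ) :
    Real.exp (-(threshold k ε δ * (ε ^ 2 / 4))) ≤ δ / (2 * numGraphlets k) := by
  have hs' : (0 : ℝ) < numGraphlets k := by exact_mod_cast hs
  have h : Real.log (2 * (numGraphlets k : ℝ) / δ) ≤ threshold k ε δ * (ε ^ 2 / 4) := by
    have := Nat.le_ceil (4 / ε ^ 2 * Real.log (2 * (numGraphlets k : ℝ) / δ))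
    calc Real.log (2 * (numGraphlets k : ℝ) / δ)
        = 4 / ε ^ 2 * Real.log (2 * (numGraphlets k : ℝ) / δ) * (ε ^ 2 / 4) := by field_simp
      _ ≤ _ := by
        unfold threshold
        gcongr
  calc _ ≤ Real.exp (-Real.log (2 * (numGraphlets k : ℝ) / δ)) := by gcongr
    _ = _ := by rw [Real.exp_neg, Real.exp_log (by positivity), inv_div]

lemma threshold_pos {k : ℕ} (hs : 0 < numGraphlets k) {ε δ : ℝ} (hε : 0 < ε) (hδ : 0 < δ)
    (hδ' : δ < 1) : 0 < threshold k ε δ := by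
  have hs' : (1 : ℝ) ≤ numGraphlets k := by exact_mod_cast hs
  refine Nat.ceil_pos.2 (mul_pos (by positivity) (Real.log_pos ?_))
  rw [lt_div_iff₀ hδ]
  linarith

/-- With the threshold of the algorithm, the two tails of the `s` graphlets add up to `δ`. -/
lemma IsRun.accuracy {k : ℕ} {V : Type*} [Finite V] {G : SimpleGraph V} {col : V → Fin k}
    {ε δ : ℝ} (hε : 0 < ε) (hε' : ε ≤ 13 / 20) (hδ : 0 < δ) (hδ' : δ < 1)
    {Ω : Type*} [MeasurableSpace Ω] {μ : Measure Ω} [IsProbabilityMeasure μ]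
    {ℱ : Filtration ℕ ‹MeasurableSpace Ω›} {J : ℕ → Ω → Treelet k} {X : ℕ → Ω → G.Subgraph}
    (hrun : IsRun col J X (threshold k ε δ) μ ℱ)
    (hopt : SwitchesOptimally col J X (threshold k ε δ)) :
    1 - δ ≤ μ.real {ω | ∀ t, StopsAt k X (threshold k ε δ) t ω → ∀ i : Graphlet k,
      (1 - ε) * graphletCount G col i ≤ count X i t ω / weight G col J i t ω ∧
      count X i t ω / weight G col J i t ω ≤ (1 + ε) * graphletCount G col i} := by
  classical
  have := Fintype.ofFinite (Graphlet k)
  obtain ⟨ω₀⟩ : Nonempty Ω := μ.nonempty_of_neZero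
  have hs := numGraphlets_pos (J 0 ω₀)
  have hpos := threshold_pos hs hε hδ hδ'
  set cbar := threshold k ε δ with hcbar
  set U : Graphlet k → Set Ω := fun i => {ω | ∃ t, StopsAt k X cbar t ω ∧
    (1 + ε) * (graphletCount G col i * weight G col J i t ω) < count X i t ω} with hU
  set L : Graphlet k → Set Ω := fun i => {ω | ∃ t, StopsAt k X cbar t ω ∧
    count X i t ω < (1 - ε) * (graphletCount G col i * weight G col J i t ω)} with hL
  set good := {ω | ∀ t, StopsAt k X cbar t ω → ∀ i : Graphlet k,
      (1 - ε) * graphletCount G col i ≤ count X i t ω / weight G col J i t ω ∧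
      count X i t ω / weight G col J i t ω ≤ (1 + ε) * graphletCount G col i} with hgood
  set q := δ / (2 * numGraphlets k) with hq
  have hs' : (0 : ℝ) < numGraphlets k := by exact_mod_cast hs
  have hreal : ∀ {A : Set Ω}, μ A ≤ ENNReal.ofReal (Real.exp (-(cbar * (ε ^ 2 / 4)))) →
      μ.real A ≤ q := fun h =>
    (ENNReal.toReal_le_of_le_ofReal (Real.exp_pos _).le h).trans (exp_neg_threshold_le hs hε hδ)
  have hUq : ∀ i, μ.real (U i) ≤ q := fun i => hreal (hrun.measure_upper_le hopt hε hε' i)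
  have hLq : ∀ i, μ.real (L i) ≤ q := fun i =>
    hreal (hrun.measure_lower_le hopt hε (by linarith) i)
  have hcover : Set.univ ⊆ good ∪ ⋃ i, (U i ∪ L i) := by
    intro ω _
    by_contra hω
    simp only [Set.mem_union, Set.mem_iUnion, not_or, not_exists] at hω
    obtain ⟨hg, hUL⟩ := hω
    refine hg fun t ht i => ?_
    have hu : ¬ _ := fun h => (hUL i).1 ⟨t, ht, h⟩
    have hl : ¬ _ := fun h => (hUL i).2 ⟨t, ht, h⟩
    rw [not_lt] at hu hl
    have hc : (0 : ℝ) < count X i t ω := by exact_mod_cast hpos.trans_le (ht.le_count i)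
    have hw0 : 0 ≤ weight G col J i t ω := Finset.sum_nonneg fun _ _ => by positivity
    -- A covered graphlet has positive weight: otherwise its count would exceed `(1 + ε) g_i w_i`.
    have hw : 0 < weight G col J i t ω := by
      refine hw0.lt_of_ne fun h => ?_
      rw [← h] at hu
      simp only [mul_zero] at hu
      linarith
    rw [le_div_iff₀ hw, div_le_iff₀ hw]
    constructor <;> linarith
  have hsum : μ.real (⋃ i, (U i ∪ L i)) ≤ δ := by
    calc μ.real (⋃ i, (U i ∪ L i)) ≤ ∑ i, μ.real (U i ∪ L i) := measureReal_iUnion_fintype_le _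
      _ ≤ ∑ _i : Graphlet k, (q + q) := Finset.sum_le_sum fun i _ =>
          (measureReal_union_le _ _).trans (add_le_add (hUq i) (hLq i))
      _ = δ := by
          rw [Finset.sum_const, Finset.card_univ, ← Nat.card_eq_fintype_card, nsmul_eq_mul,
            ← numGraphlets, hq]
          field_simp
          ring
  have h1 : (1 : ℝ) ≤ μ.real good + δ := by
    calc (1 : ℝ) = μ.real Set.univ := by simp
      _ ≤ μ.real (good ∪ ⋃ i, (U i ∪ L i)) := measureReal_mono hcover
      _ ≤ μ.real good + μ.real (⋃ i, (U i ∪ L i)) := measureReal_union_le _ _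
      _ ≤ μ.real good + δ := by gcongr
  linarith

/-! ### Termination -/

section Termination

variable {k : ℕ} {V : Type*} {G : SimpleGraph V} {col : V → Fin k} {Ω : Type*}
  [MeasurableSpace Ω] {μ : Measure Ω} {ℱ : Filtration ℕ ‹MeasurableSpace Ω›}
  {J : ℕ → Ω → Treelet k} {X : ℕ → Ω → G.Subgraph} {cbar : ℕ} [Finite V]

open scoped ENNReal

lemma probSpans_lt_one_iff {j : Treelet k} (hj : 0 < treeletCount G col j)
    (C : Set (Graphlet k)) :
    probSpans G col j C < 1 ↔ ∃ x ∈ treeletCopies G col j, ∃ i ∉ C, Spans x i := by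
  have hn : (0 : ℝ) < treeletCount G col j := by exact_mod_cast hj
  rw [probSpans, div_lt_one hn, Nat.cast_lt]
  constructor
  · intro h
    obtain ⟨x, hx, hx'⟩ := Set.exists_mem_notMem_of_ncard_lt_ncard h
    obtain ⟨i, hi⟩ := exists_spans hx
    exact ⟨x, hx, i, fun hiC => hx' ⟨hx, i, hiC, hi⟩, hi⟩
  · rintro ⟨x, hx, i, hiC, hi⟩
    refine Set.ncard_lt_ncard ⟨fun y hy => hy.1, fun h => ?_⟩ (Set.toFinite _)
    obtain ⟨-, i', hi', hs⟩ := h hx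
    exact hiC (hi.unique hs ▸ hi')

/-- If some uncovered graphlet occurs in `G`, then an optimally selected treelet has a copy that
spans an uncovered graphlet, since a spanning tree of that graphlet is a competitor. -/
lemma MinimizesCovered.exists_spans_notMem (hg : ∀ i : Graphlet k, 0 < graphletCount G col i)
    {j : Treelet k} {C : Set (Graphlet k)} (hC : C ≠ Set.univ) (h : MinimizesCovered G col j C) :
    ∃ x ∈ treeletCopies G col j, ∃ i ∉ C, Spans x i := by
  obtain ⟨i, hi⟩ := (Set.ne_univ_iff_exists_notMem C).1 hC
  obtain ⟨j', hj'⟩ := exists_sigma_pos i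
  have hpos := Nat.mul_pos (hg i) hj'
  rw [← ncard_copies_spanning, Set.ncard_pos (Set.toFinite _)] at hpos
  obtain ⟨x, hx, hxi⟩ := hpos
  have hcount : 0 < treeletCount G col j' := (Set.ncard_pos (Set.toFinite _)).2 ⟨x, hx⟩
  rw [← probSpans_lt_one_iff h.1]
  exact (h.2 j' hcount).trans_lt ((probSpans_lt_one_iff hcount C).2 ⟨x, hx, i, hi, hxi⟩)

/-- While the algorithm runs, the next draw can span an uncovered graphlet: the covered set changes
only when a new treelet is selected. -/
lemma IsRun.exists_spans_uncovered (hrun : IsRun col J X cbar μ ℱ)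
    (hopt : SwitchesOptimally col J X cbar) (hg : ∀ i : Graphlet k, 0 < graphletCount G col i)
    (hcbar : 0 < cbar) {t : ℕ} {ω : Ω} (h : Running k X cbar t ω) :
    ∃ x ∈ treeletCopies G col (J t ω),
      ∃ i ∉ (covered X cbar t ω : Set (Graphlet k)), Spans x i := by
  induction t with
  | zero =>
    obtain ⟨x, hx⟩ := (Set.ncard_pos (Set.toFinite _)).1 (hrun.initial ω)
    obtain ⟨i, hi⟩ := exists_spans hx
    exact ⟨x, hx, i, by simpa [covered, count] using hcbar.ne', hi⟩
  | succ t ih =>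
    have ht : Running k X cbar t ω := h.anti t.le_succ
    by_cases hc : ∀ i : Graphlet k, Spans (X t ω) i → count X i (t + 1) ω < cbar
    · have hcov : (covered X cbar (t + 1) ω : Set (Graphlet k)) = covered X cbar t ω := by
        refine Set.Subset.antisymm (fun i hi => ?_) (covered_mono ω t.le_succ)
        have hns : ¬ Spans (X t ω) i := fun hs => (hc i hs).not_ge hi
        have hi' : cbar ≤ count X i (t + 1) ω := hi
        rw [count_succ, if_neg hns, add_zero] at hi'
        exact hi'
      rw [hrun.keep t ω ht hc, hcov]
      exact ih ht
    · push Not at hc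
      obtain ⟨i, hi, hi'⟩ := hc
      exact (hopt t ω ht i hi hi').exists_spans_notMem hg h

lemma IsRun.measurableSet_progress (hrun : IsRun col J X cbar μ ℱ) (t : ℕ) :
    MeasurableSet (Progress X k cbar t) := by
  have : Progress X k cbar t = {ω | Running k X cbar t ω} ∩
      ⋃ i : Graphlet k, {ω | count X i t ω < cbar} ∩ {ω | Spans (X t ω) i} := by
    ext ω
    simp [Progress, covered]
  rw [this]
  refine (ℱ.le t _ (hrun.measurableSet_running t)).inter (MeasurableSet.iUnion fun i => ?_)
  exact (ℱ.le t _ (hrun.measurable_count i t (MeasurableSet.of_discrete (s := Set.Iio cbar)))).inter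
    (ℱ.le _ _ (measurableSet_of_fibers (hrun.adapted_X t) fun x => Spans x i))

/-- Every executed iteration makes progress with conditional probability at least the inverse of the
number of subgraphs of `G`. -/
lemma IsRun.measure_running_le (hrun : IsRun col J X cbar μ ℱ)
    (hopt : SwitchesOptimally col J X cbar) (hg : ∀ i : Graphlet k, 0 < graphletCount G col i)
    (hcbar : 0 < cbar) (t : ℕ) :
    μ {ω | Running k X cbar t ω} ≤ Nat.card G.Subgraph * μ (Progress X k cbar t) := by
  -- On each piece the treelet and the covered set are fixed, and so is a copy making progress.
  let A : Treelet k × Set (Graphlet k) → Set Ω := fun a =>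
    ({ω | Running k X cbar t ω} ∩ {ω | J t ω = a.1}) ∩ {ω | covered X cbar t ω = a.2}
  have hA : ∀ a, MeasurableSet[ℱ t] (A a) := fun a =>
    ((hrun.measurableSet_running t).inter (hrun.adapted_J t a.1)).inter
      (hrun.measurableSet_covered t a.2)
  have hU : {ω | Running k X cbar t ω} = ⋃ a, A a := by
    ext ω
    simp [A]
  have hdisj : Pairwise (Function.onFun Disjoint fun a => A a ∩ Progress X k cbar t) := by
    intro a b hab
    refine Set.disjoint_left.2 ?_
    rintro ω ⟨⟨⟨_, h1⟩, h2⟩, _⟩ ⟨⟨⟨_, h3⟩, h4⟩, _⟩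
    exact hab (Prod.ext (h1.symm.trans h3) (h2.symm.trans h4))
  have hpiece : ∀ a, μ (A a) ≤ Nat.card G.Subgraph * μ (A a ∩ Progress X k cbar t) := by
    intro a
    rcases Set.eq_empty_or_nonempty (A a) with h | h
    · simp [h]
    obtain ⟨ω₀, ⟨h0, h1⟩, h2⟩ := h
    obtain ⟨x, hx, i, hi, hs⟩ := hrun.exists_spans_uncovered hopt hg hcbar h0
    have h1' : J t ω₀ = a.1 := h1
    have h2' : covered X cbar t ω₀ = a.2 := h2
    rw [h1'] at hx
    rw [h2'] at hi
    have hj : treeletCount G col a.1 ≠ 0 :=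
      ((Set.ncard_pos (Set.toFinite _)).2 ⟨x, hx⟩).ne'
    have hle : treeletCount G col a.1 ≤ Nat.card G.Subgraph := by
      rw [← Set.ncard_univ]
      exact Set.ncard_le_ncard (Set.subset_univ _) (Set.toFinite _)
    calc μ (A a) = treeletCount G col a.1 * μ (A a ∩ {ω | X t ω = x}) := by
          rw [hrun.uniform t a.1 x hx (A a) (hA a) fun ω hω => hω.1,
            ENNReal.mul_div_cancel (by exact_mod_cast hj) (ENNReal.natCast_ne_top _)]
      _ ≤ Nat.card G.Subgraph * μ (A a ∩ Progress X k cbar t) := by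
          refine mul_le_mul' (by exact_mod_cast hle) (measure_mono ?_)
          rintro ω ⟨hω, hX⟩
          have h3 : covered X cbar t ω = a.2 := hω.2
          have h4 : X t ω = x := hX
          exact ⟨hω, hω.1.1, i, by rwa [h3], by rwa [h4]⟩
  calc μ {ω | Running k X cbar t ω} ≤ ∑' a, μ (A a) := by rw [hU]; exact measure_iUnion_le _
    _ ≤ ∑' a, Nat.card G.Subgraph * μ (A a ∩ Progress X k cbar t) := ENNReal.tsum_le_tsum hpiece
    _ = Nat.card G.Subgraph * μ (⋃ a, A a ∩ Progress X k cbar t) := by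
        rw [ENNReal.tsum_mul_left, measure_iUnion hdisj fun a =>
          (ℱ.le t _ (hA a)).inter (hrun.measurableSet_progress t)]
    _ ≤ _ := by
        gcongr
        exact Set.iUnion_subset fun _ => Set.inter_subset_right

lemma IsRun.ae_exists_stopsAt [IsProbabilityMeasure μ] (hrun : IsRun col J X cbar μ ℱ)
    (hopt : SwitchesOptimally col J X cbar) (hg : ∀ i : Graphlet k, 0 < graphletCount G col i)
    (hcbar : 0 < cbar) : ∀ᵐ ω ∂μ, ∃ t, StopsAt k X cbar t ω := by
  set D := {ω | ∀ t, Running k X cbar t ω} with hD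
  have hprogress : ∀ n : ℕ, ∑ t ∈ Finset.range n, μ (Progress X k cbar t) ≤
      (numGraphlets k * cbar : ℕ) := by
    intro n
    calc ∑ t ∈ Finset.range n, μ (Progress X k cbar t)
        = ∫⁻ ω, ∑ t ∈ Finset.range n, (Progress X k cbar t).indicator 1 ω ∂μ := by
          rw [lintegral_finsetSum _ fun t _ =>
            measurable_one.indicator (hrun.measurableSet_progress t)]
          exact Finset.sum_congr rfl fun t _ =>
            (lintegral_indicator_one (hrun.measurableSet_progress t)).symm
      _ ≤ ∫⁻ _, (numGraphlets k * cbar : ℕ) ∂μ := by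
          refine lintegral_mono fun ω => ?_
          have h := sum_indicator_progress_le (X := X) (k := k) (cbar := cbar) n ω
          refine le_trans (le_of_eq ?_) (Nat.cast_le.2 h)
          push_cast
          refine Finset.sum_congr rfl fun t _ => ?_
          by_cases hω : ω ∈ Progress X k cbar t <;> simp [hω]
      _ = _ := by simp
  have hbound : ∀ n : ℕ, n * μ D ≤ Nat.card G.Subgraph * (numGraphlets k * cbar : ℕ) := by
    intro n
    calc n * μ D = ∑ _t ∈ Finset.range n, μ D := by simp
      _ ≤ ∑ t ∈ Finset.range n, Nat.card G.Subgraph * μ (Progress X k cbar t) :=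
          Finset.sum_le_sum fun t _ =>
            (measure_mono fun ω (hω : ∀ u, Running k X cbar u ω) => hω t).trans
            (hrun.measure_running_le hopt hg hcbar t)
      _ ≤ _ := by
          rw [← Finset.mul_sum]
          gcongr
          exact hprogress n
  have hD0 : μ D = 0 := by
    by_contra h
    obtain ⟨n, hn⟩ := ENNReal.exists_nat_mul_gt h
      (ENNReal.mul_ne_top (ENNReal.natCast_ne_top (Nat.card G.Subgraph))
        (ENNReal.natCast_ne_top (numGraphlets k * cbar)))
    exact (hbound n).not_gt hn
  have hae : ∀ᵐ ω ∂μ, ω ∉ D := measure_eq_zero_iff_ae_notMem.1 hD0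
  filter_upwards [hae] with ω hω
  exact exists_stopsAt (not_forall.1 hω)

end Termination

end AGS

theorem mainTheorem2 {k : ℕ} {V : Type*} [Finite V] (G : SimpleGraph V) (col : V → Fin k)
    (ε δ : ℝ) (hε : 0 < ε) (hε' : ε ≤ 13 / 20) (hδ : 0 < δ) (hδ' : δ < 1)
    {Ω : Type*} [MeasurableSpace Ω] (μ : MeasureTheory.Measure Ω)
    [MeasureTheory.IsProbabilityMeasure μ]
    (ℱ : MeasureTheory.Filtration ℕ ‹MeasurableSpace Ω›)
    (J : ℕ → Ω → AGS.Treelet k) (X : ℕ → Ω → G.Subgraph)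
    (hrun : AGS.IsRun col J X (AGS.threshold k ε δ) μ ℱ)
    (hopt : AGS.SwitchesOptimally col J X (AGS.threshold k ε δ)) :
    1 - δ ≤ μ.real {ω | ∀ t, AGS.StopsAt k X (AGS.threshold k ε δ) t ω →
      ∀ i : AGS.Graphlet k,
        (1 - ε) * AGS.graphletCount G col i ≤ AGS.count X i t ω / AGS.weight G col J i t ω ∧
        AGS.count X i t ω / AGS.weight G col J i t ω ≤ (1 + ε) * AGS.graphletCount G col i} ∧
    ((∀ i : AGS.Graphlet k, 0 < AGS.graphletCount G col i) →
      ∀ᵐ ω ∂μ, ∃ t, AGS.StopsAt k X (AGS.threshold k ε δ) t ω) := by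
  obtain ⟨ω₀⟩ : Nonempty Ω := μ.nonempty_of_neZero
  exact ⟨hrun.accuracy hε hε' hδ hδ' hopt, fun hg => hrun.ae_exists_stopsAt hopt hg
    (AGS.threshold_pos (AGS.numGraphlets_pos (J 0 ω₀)) hε hδ hδ')⟩
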